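/- Let $n\ge 3$ and let $S_{n-2}\le S_n$ be the subgroup permuting the first $n-2$ points and fixing the last two. For a partition $\lambda\vdash n$ let $\rho_\lambda$ be the Young orthogonal representation (YOR): the real matrix representation of $S_n$ with rows and columns indexed by the standard Young tableaux of shape $\lambda$ in which, for $1\le i<n$, the column of $\rho_\lambda((i\;\,i+1))$ indexed by $T$ has the entry $1/d$ on the diagonal, the entry $\sqrt{1-1/d^2}$ in the row of the tableau obtained from $T$ by exchanging $i$ and $i+1$ (if that tableau is standard), and zeros elsewhere; here $d=c_T(i+1)-c_T(i)$, and $c_T(k)$ is the content (column minus row) of the box of $T$ containing $k$. For $f:S_n/S_{n-2}\to\mathbb{C}$, regarded as a function on $S_n$ with $f(\sigma h)=f(\sigma)$ for $h\in S_{n-2}$, put $$\hat f(\lambda)=\frac1{n!}\sum_{g\in S_n} f(g)\,\rho_\lambda(g).$$ Let $\Lambda_n$ be the set of those among $(n)$, $(n-1,1)$, $(n-2,2)$, $(n-2,1,1)$ that are partitions of $n$ (all four if $n\ge 4$; all but $(n-2,2)$ if $n=3$), and let $C_\lambda$ be the set of standard tableaux of shape $\lambda$ whose entries $1,\dots,n-2$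 all lie in the first row. Then: 1. $\hat f(\lambda)=0$ for every $f$ and every $\lambda\vdash n$ with $\lambda\notin\Lambda_n$. 2. For every $f$ and every $\lambda\in\Lambda_n$, all columns of $\hat f(\lambda)$ with index outside $C_\lambda$ are zero; and there is an $f$ such that, for every $\lambda\in\Lambda_n$, all columns of $\hat f(\lambda)$ with index in $C_\lambda$ are non-zero. So $C_\lambda$, which does not depend on $f$, is exactly the pattern of (possibly) non-zero columns. 3. For $\lambda\in\Lambda_n$ the sizes of the square matrix $\hat f(\lambda)$ and of its pattern are as follows: - $\lambda=(n)$: size $1$, and $|C_\lambda|=1$ (one scalar entry); - $\lambda=(n-1,1)$: size $n-1$, and $|C_\lambda|=2$; - $\lambda=(n-2,2)$ (for $n\ge4$): size $\frac{n(n-3)}2$, and $|C_\lambda|=1$; - $\lambda=(n-2,1,1)$: size $\frac{(n-1)(n-2)}2$, and $|C_\lambda|=1$. -/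

import Mathlib

/-! ### The Coxeter presentation of the symmetric group, as an extension principle -/

namespace CoxeterExtension

section
variable {G : Type*} [Monoid G] (t : ℕ → G) (m : ℕ)

/-- The word `t_{m-k+1} ⋯ t_{m-1} t_m`. -/
def word : ℕ → G
  | 0 => 1
  | k + 1 => t (m - k) * word k

/-- The submonoid generated by `t_0, …, t_{m-1}`. -/
def gen : Submonoid G := Submonoid.closure (t '' Set.Iio m)

variable {t m}

theorem gen_mem {i : ℕ} (h : i < m) : t i ∈ gen t m :=
  Submonoid.subset_closure ⟨i, h, rfl⟩

theorem word_low {N : ℕ} (hmN : m < N)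
    (hcomm : ∀ i j, i + 1 < j → j < N → t i * t j = t j * t i) :
    ∀ k ≤ m + 1, ∀ i, i + k < m → t i * word t m k = word t m k * t i := by
  intro k
  induction k with
  | zero => intro _ i _; simp [word]
  | succ k ih =>
    intro hk i hi
    rw [word, ← mul_assoc, hcomm i (m - k) (by omega) (by omega), mul_assoc,
      ih (by omega) i (by omega), mul_assoc]

theorem word_high {N : ℕ} (hmN : m < N)
    (hcomm : ∀ i j, i + 1 < j → j < N → t i * t j = t j * t i)
    (hbraid : ∀ i, i + 1 < N → t i * t (i + 1) * t i = t (i + 1) * t i * t (i + 1)) :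
    ∀ k ≤ m + 1, ∀ i, i + 1 ≤ m → m < i + k →
      t (i + 1) * word t m k = word t m k * t i := by
  intro k
  induction k with
  | zero => intro _ i _ _; omega
  | succ k ih =>
    intro hk i hi hik
    by_cases h : m < i + k
    · rw [word, ← mul_assoc, ← hcomm (m - k) (i + 1) (by omega) (by omega), mul_assoc,
        ih (by omega) i (by omega) h, mul_assoc]
    · obtain ⟨k', rfl⟩ : ∃ k', k = k' + 1 := ⟨k - 1, by omega⟩
      have e1 : m - (k' + 1) = i := by omega
      have e2 : m - k' = i + 1 := by omega
      rw [word, word, e1, e2, ← mul_assoc, ← mul_assoc, ← hbraid i (by omega),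
        mul_assoc _ (t i), word_low hmN hcomm k' (by omega) i (by omega)]
      simp only [mul_assoc]

theorem mem_gen_succ {N : ℕ} (hmN : m < N)
    (hsq : ∀ i < N, t i * t i = 1)
    (hcomm : ∀ i j, i + 1 < j → j < N → t i * t j = t j * t i)
    (hbraid : ∀ i, i + 1 < N → t i * t (i + 1) * t i = t (i + 1) * t i * t (i + 1))
    {x : G} (hx : x ∈ gen t (m + 1)) :
    ∃ k ≤ m + 1, ∃ p ∈ gen t m, x = word t m k * p := by
  refine Submonoid.closure_induction_left (motive := fun x _ =>
    ∃ k ≤ m + 1, ∃ p ∈ gen t m, x = word t m k * p) ?_ ?_ hx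
  · exact ⟨0, by omega, 1, one_mem _, by simp [word]⟩
  · rintro _ ⟨i, hi, rfl⟩ _ _ ⟨k, hk, p, hp, rfl⟩
    have hi' : i < m + 1 := hi
    rcases lt_trichotomy (i + k) m with h | h | h
    · exact ⟨k, hk, t i * p, mul_mem (gen_mem (by omega)) hp, by
        rw [← mul_assoc, word_low hmN hcomm k hk i h, mul_assoc]⟩
    · refine ⟨k + 1, by omega, p, hp, ?_⟩
      rw [word, mul_assoc, show m - k = i by omega]
    · by_cases h2 : i + k = m + 1
      · obtain ⟨k', rfl⟩ : ∃ k', k = k' + 1 := ⟨k - 1, by omega⟩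
        refine ⟨k', by omega, p, hp, ?_⟩
        rw [word, show m - k' = i by omega, ← mul_assoc, ← mul_assoc, hsq i (by omega), one_mul]
      · obtain ⟨i', rfl⟩ : ∃ i', i = i' + 1 := ⟨i - 1, by omega⟩
        refine ⟨k, hk, t i' * p, mul_mem (gen_mem (by omega)) hp, ?_⟩
        rw [← mul_assoc, word_high hmN hcomm hbraid k hk i' (by omega) (by omega), mul_assoc]

end

/-- The transposition exchanging `i` and `i + 1` in `{0, …, n-1}`. -/
def adj {n : ℕ} (i : ℕ) (h : i + 1 < n) : Equiv.Perm (Fin n) :=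
  Equiv.swap ⟨i, Nat.lt_of_succ_lt h⟩ ⟨i + 1, h⟩

/-- The pair of a transposition and its prescribed image. -/
def pairs {n : ℕ} {A : Type*} [Monoid A] (M : ∀ i, i + 1 < n → A) (i : ℕ) :
    Equiv.Perm (Fin n) × A :=
  if h : i + 1 < n then (adj i h, M i h) else 1

theorem adj_of_lt {n : ℕ} {i : ℕ} (h : i + 1 < n) (a : Fin n) (ha : a.val ≠ i)
    (ha' : a.val ≠ i + 1) : adj i h a = a :=
  Equiv.swap_apply_of_ne_of_ne (fun e => ha (by simp [e])) (fun e => ha' (by simp [e]))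

theorem adj_mul_self {n : ℕ} {i : ℕ} (h : i + 1 < n) : adj i h * adj i h = 1 :=
  Equiv.swap_mul_self _ _

theorem adj_comm {n : ℕ} {i j : ℕ} (hi : i + 1 < n) (hj : j + 1 < n) (hij : i + 1 < j) :
    adj i hi * adj j hj = adj j hj * adj i hi := by
  refine Equiv.Perm.Disjoint.commute fun a => ?_
  by_cases h : a.val = i ∨ a.val = i + 1
  · exact Or.inr (adj_of_lt hj a (by omega) (by omega))
  · exact Or.inl (adj_of_lt hi a (by omega) (by omega))

theorem adj_braid {n : ℕ} {i : ℕ} (h : i + 1 < n) (h' : i + 1 + 1 < n) :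
    adj i h * adj (i + 1) h' * adj i h = adj (i + 1) h' * adj i h * adj (i + 1) h' := by
  have n1 : (⟨i, by omega⟩ : Fin n) ≠ ⟨i + 1, h⟩ := by simp
  have n2 : (⟨i, by omega⟩ : Fin n) ≠ ⟨i + 1 + 1, h'⟩ := by simp [Fin.ext_iff]; omega
  have n3 : (⟨i + 1 + 1, h'⟩ : Fin n) ≠ ⟨i + 1, h⟩ := by simp
  have e1 := Equiv.swap_mul_swap_mul_swap n1 n2
  have e2 := Equiv.swap_mul_swap_mul_swap n3 n2.symm
  have c1 : Equiv.swap (⟨i + 1, h⟩ : Fin n) ⟨i, by omega⟩ = Equiv.swap ⟨i, by omega⟩ ⟨i + 1, h⟩ :=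
    Equiv.swap_comm _ _
  have c2 : Equiv.swap (⟨i + 1 + 1, h'⟩ : Fin n) ⟨i + 1, h⟩ =
    Equiv.swap ⟨i + 1, h⟩ ⟨i + 1 + 1, h'⟩ := Equiv.swap_comm _ _
  rw [c1, c2] at e2
  unfold adj
  rw [e1, e2, Equiv.swap_comm]

section
variable {n : ℕ} {A : Type*} [Monoid A] {M : ∀ i, i + 1 < n → A}

theorem fix_of_mem_gen {m : ℕ} {p : Equiv.Perm (Fin n) × A} (hp : p ∈ gen (pairs M) m) :
    ∀ a : Fin n, m < a.val → p.1 a = a := by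
  refine Submonoid.closure_induction (motive := fun p _ => ∀ a : Fin n, m < a.val → p.1 a = a)
    ?_ ?_ ?_ hp
  · rintro _ ⟨i, hi, rfl⟩ a ha
    have hi' : i < m := hi
    unfold pairs
    split_ifs with h
    · exact adj_of_lt h a (by omega) (by omega)
    · rfl
  · intro a _; rfl
  · intro x y _ _ hx hy a ha
    simp [hy a ha, hx a ha]

theorem word_apply {m : ℕ} (hm : m + 1 < n) :
    ∀ k ≤ m + 1, ((word (pairs M) m k).1 ⟨m + 1, hm⟩ : Fin n).val = m + 1 - k := by
  intro k
  induction k with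
  | zero => intro _; simp [word]
  | succ k ih =>
    intro hk
    have h := ih (by omega)
    have h1 : m - k + 1 < n := by omega
    simp only [word, Prod.fst_mul, Equiv.Perm.mul_apply, pairs, h1, dite_true]
    rw [show (word (pairs M) m k).1 ⟨m + 1, hm⟩ = (⟨m - k + 1, h1⟩ : Fin n) from
      Fin.ext (by rw [h]; simp; omega)]
    rw [adj, Equiv.swap_apply_right]
    simp

/-- Elements satisfying the Coxeter relations of type `A` are the images of the adjacent
transpositions under a homomorphism from the symmetric group. -/
theorem exists_hom
    (hsq : ∀ i h, M i h * M i h = 1)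
    (hcomm : ∀ i j hi hj, i + 1 < j → M i hi * M j hj = M j hj * M i hi)
    (hbraid : ∀ i h h', M i h * M (i + 1) h' * M i h = M (i + 1) h' * M i h * M (i + 1) h') :
    ∃ ρ : Equiv.Perm (Fin n) →* A, ∀ i h, ρ (adj i h) = M i h := by
  have sq : ∀ i < n - 1, pairs M i * pairs M i = 1 := by
    intro i hi
    have h : i + 1 < n := by omega
    simp only [pairs, h, dite_true]
    exact Prod.ext (adj_mul_self h) (hsq i h)
  have comm : ∀ i j, i + 1 < j → j < n - 1 → pairs M i * pairs M j = pairs M j * pairs M i := by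
    intro i j hij hj
    have h1 : i + 1 < n := by omega
    have h2 : j + 1 < n := by omega
    simp only [pairs, h1, h2, dite_true]
    exact Prod.ext (adj_comm h1 h2 hij) (hcomm i j h1 h2 hij)
  have braid : ∀ i, i + 1 < n - 1 → pairs M i * pairs M (i + 1) * pairs M i =
      pairs M (i + 1) * pairs M i * pairs M (i + 1) := by
    intro i hi
    have h1 : i + 1 < n := by omega
    have h2 : i + 1 + 1 < n := by omega
    simp only [pairs, h1, h2, dite_true]
    exact Prod.ext (adj_braid h1 h2) (hbraid i h1 h2)
  have key : ∀ m, m ≤ n - 1 → ∀ p ∈ gen (pairs M) m, p.1 = 1 → p = 1 := by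
    intro m
    induction m with
    | zero =>
      intro _ p hp _
      simpa [gen] using hp
    | succ m ih =>
      intro hm p hp h1
      obtain ⟨k, hk, q, hq, rfl⟩ := mem_gen_succ (N := n - 1) (by omega) sq comm braid hp
      have hmn : m + 1 < n := by omega
      have e := word_apply (M := M) hmn k hk
      have e2 := congrArg (fun g : Equiv.Perm (Fin n) => (g ⟨m + 1, hmn⟩).val) h1
      simp only [Prod.fst_mul, Equiv.Perm.mul_apply, Equiv.Perm.one_apply] at e2
      rw [fix_of_mem_gen hq ⟨m + 1, hmn⟩ (by simp), e] at e2
      obtain rfl : k = 0 := by omega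
      simp only [word, one_mul] at h1 ⊢
      exact ih (by omega) q hq h1
  set P := gen (pairs M) (n - 1) with hP
  have inv : ∀ p ∈ P, ∃ q ∈ P, q * p = 1 ∧ p * q = 1 := by
    intro p hp
    refine Submonoid.closure_induction (motive := fun p _ => ∃ q ∈ P, q * p = 1 ∧ p * q = 1)
      ?_ ?_ ?_ hp
    · rintro _ ⟨i, hi, rfl⟩
      exact ⟨_, gen_mem hi, sq i hi, sq i hi⟩
    · exact ⟨1, one_mem _, by simp, by simp⟩
    · rintro x y _ _ ⟨x', hx', hx1, hx2⟩ ⟨y', hy', hy1, hy2⟩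
      refine ⟨y' * x', mul_mem hy' hx', ?_, ?_⟩
      · rw [mul_assoc, ← mul_assoc x', hx1, one_mul, hy1]
      · rw [mul_assoc, ← mul_assoc y, hy2, one_mul, hx2]
  have mem_adj : ∀ i h, (adj i h, M i h) ∈ P := by
    intro i h
    have h' : pairs M i ∈ P := gen_mem (by omega)
    simpa only [pairs, h, dite_true] using h'
  have surj : ∀ g : Equiv.Perm (Fin n), ∃ a : A, (g, a) ∈ P := by
    intro g
    have hg : g ∈ P.map (MonoidHom.fst (Equiv.Perm (Fin n)) A) := by
      rcases n with _ | n
      · rw [Subsingleton.elim g 1]; exact one_mem _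
      · have : (⊤ : Submonoid (Equiv.Perm (Fin (n + 1)))) ≤
            P.map (MonoidHom.fst (Equiv.Perm (Fin (n + 1))) A) := by
          rw [← Equiv.Perm.mclosure_swap_castSucc_succ, Submonoid.closure_le]
          rintro _ ⟨i, rfl⟩
          exact ⟨_, mem_adj i.val (by omega), rfl⟩
        exact this trivial
    obtain ⟨⟨g', a⟩, h, rfl⟩ := hg
    exact ⟨a, h⟩
  have bij : Function.Bijective (Prod.fst ∘ P.subtype) := by
    constructor
    · rintro ⟨x, hx⟩ ⟨y, hy⟩ hxy
      have hxy' : x.1 = y.1 := hxy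
      obtain ⟨q, hq, hq1, hq2⟩ := inv x hx
      have h1 : q * y = 1 := key (n - 1) le_rfl _ (mul_mem hq hy) (by
        rw [Prod.fst_mul, ← hxy', ← Prod.fst_mul, hq1]; rfl)
      refine Subtype.ext ?_
      calc x = x * (q * y) := by rw [h1, mul_one]
        _ = y := by rw [← mul_assoc, hq2, one_mul]
    · intro g
      obtain ⟨a, ha⟩ := surj g
      exact ⟨⟨_, ha⟩, rfl⟩
  obtain ⟨ρ, hρ⟩ := Submonoid.exists_eq_mgraph bij
  refine ⟨ρ, fun i h => ?_⟩
  have := mem_adj i h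
  rw [hρ] at this
  exact MonoidHom.mem_mgraph.1 this

end

end CoxeterExtension

/-! ### Standard Young tableaux and Young's orthogonal form -/

/-- A standard Young tableau of shape `μ` with entries `0, …, n-1`: `cell k` is the box
(row, column) that contains the entry `k`; entries strictly increase along rows and columns. -/
@[ext]
structure StdTableau (n : ℕ) (μ : YoungDiagram) where
  cell : Fin n ≃ μ.cells
  row_lt : ∀ k l, (cell k).1.1 = (cell l).1.1 → (cell k).1.2 < (cell l).1.2 → k < l
  col_lt : ∀ k l, (cell k).1.2 = (cell l).1.2 → (cell k).1.1 < (cell l).1.1 → k < l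

namespace StdTableau

variable {n : ℕ} {μ : YoungDiagram}

noncomputable instance : Fintype (StdTableau n μ) :=
  Fintype.ofInjective StdTableau.cell fun _ _ h => StdTableau.ext h

noncomputable instance : DecidableEq (StdTableau n μ) := Classical.decEq _

/-- The content (column minus row) of the box that contains the entry `k`. -/
def content (x : Fin n ≃ μ.cells) (k : Fin n) : ℤ := ((x k).1.2 : ℤ) - ((x k).1.1 : ℤ)

/-- The axial distance from the entry `i` to the entry `i + 1`. -/
def axial (x : Fin n ≃ μ.cells) (i : ℕ) (h : i + 1 < n) : ℤ :=
  content x ⟨i + 1, h⟩ - content x ⟨i, Nat.lt_of_succ_lt h⟩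

/-- Exchanging the entries `i` and `i + 1` of a filling. -/
def exch (x : Fin n ≃ μ.cells) (i : ℕ) (h : i + 1 < n) : Fin n ≃ μ.cells :=
  (CoxeterExtension.adj i h).trans x

open Classical in
/-- The matrix of the transposition of `i` and `i + 1` in Young's orthogonal form: with `d` the
axial distance from `i` to `i + 1` in `T`, the column of `T` has the entry `1 / d` on the diagonal
and `√(1 - 1 / d²)` in the row of the tableau obtained from `T` by exchanging `i` and `i + 1`
(if that tableau is standard), and zeros elsewhere. -/
noncomputable def youngMatrix (n : ℕ) (μ : YoungDiagram) (i : ℕ) (h : i + 1 < n) :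
    Matrix (StdTableau n μ) (StdTableau n μ) ℝ :=
  Matrix.of fun S T =>
    if S = T then 1 / (axial T.cell i h : ℝ)
    else if S.cell = exch T.cell i h then √(1 - 1 / (axial T.cell i h : ℝ) ^ 2)
    else 0

/-- Row and column condition for a filling. -/
def IsStd (x : Fin n ≃ μ.cells) : Prop :=
  (∀ k l, (x k).1.1 = (x l).1.1 → (x k).1.2 < (x l).1.2 → k < l) ∧
  (∀ k l, (x k).1.2 = (x l).1.2 → (x k).1.1 < (x l).1.1 → k < l)

theorem cell_eq_iff (x : Fin n ≃ μ.cells) {k l : Fin n} (h1 : (x k).1.1 = (x l).1.1)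
    (h2 : (x k).1.2 = (x l).1.2) : k = l :=
  x.injective (Subtype.ext (Prod.ext h1 h2))

theorem exists_entry (x : Fin n ≃ μ.cells) (l : Fin n) {r c : ℕ} (hr : r ≤ (x l).1.1)
    (hc : c ≤ (x l).1.2) : ∃ m, (x m).1.1 = r ∧ (x m).1.2 = c := by
  have h : (r, c) ∈ μ.cells := μ.up_left_mem hr hc (x l).2
  exact ⟨x.symm ⟨_, h⟩, by simp, by simp⟩

/-- Entries on the same diagonal of a standard tableau differ by at least `3`. -/
theorem diag_aux {x : Fin n ≃ μ.cells} (hx : IsStd x) {k l : Fin n}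
    (hc : content x k = content x l) (hr : (x k).1.1 < (x l).1.1) : k.val + 3 ≤ l.val := by
  unfold content at hc
  obtain ⟨p, hp1, hp2⟩ := exists_entry x l (r := (x k).1.1) (c := (x l).1.2) hr.le le_rfl
  obtain ⟨q, hq1, hq2⟩ := exists_entry x l (r := (x l).1.1) (c := (x k).1.2) le_rfl (by omega)
  have h1 : k < p := hx.1 k p hp1.symm (by omega)
  have h2 : p < l := hx.2 p l hp2 (by omega)
  have h3 : k < q := hx.2 k q hq2.symm (by omega)
  have h4 : q < l := hx.1 q l hq1 (by omega)
  have h5 : p.val ≠ q.val := by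
    intro e
    have : p = q := Fin.ext e
    subst this
    omega
  have : k.val < p.val := h1
  have : p.val < l.val := h2
  have : k.val < q.val := h3
  have : q.val < l.val := h4
  omega

theorem content_ne {x : Fin n ≃ μ.cells} (hx : IsStd x) {k l : Fin n} (h : k.val < l.val)
    (h' : l.val < k.val + 3) : content x k ≠ content x l := by
  intro hc
  rcases lt_trichotomy (x k).1.1 (x l).1.1 with hr | hr | hr
  · have := diag_aux hx hc hr; omega
  · have e : k = l := cell_eq_iff x hr (by unfold content at hc; omega)
    subst e; omega
  · have := diag_aux hx hc.symm hr; omega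

/-- If the exchange leads out of the standard tableaux, the axial distance is `1` or `-1`. -/
theorem axial_of_not_std {x : Fin n ≃ μ.cells} (hx : IsStd x) {i : ℕ} {h : i + 1 < n}
    (hs : ¬ IsStd (exch x i h)) : axial x i h = 1 ∨ axial x i h = -1 := by
  have hlt : i < n := Nat.lt_of_succ_lt h
  have aux : ∀ k l : Fin n, CoxeterExtension.adj i h k < CoxeterExtension.adj i h l → ¬ k < l →
      CoxeterExtension.adj i h k = ⟨i, hlt⟩ ∧ CoxeterExtension.adj i h l = ⟨i + 1, h⟩ := by
    intro k l
    simp only [CoxeterExtension.adj, Equiv.swap_apply_def, Fin.ext_iff, Fin.lt_def]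
    split_ifs <;> (try dsimp only) <;> omega
  by_contra hd
  apply hs
  unfold axial content at hd
  constructor
  · intro k l h1 h2
    by_contra hkl
    have h3 := hx.1 _ _ h1 h2
    obtain ⟨e1, e2⟩ := aux k l h3 hkl
    simp only [exch, Equiv.trans_apply, e1, e2] at h1 h2
    obtain ⟨p, hp1, hp2⟩ := exists_entry x ⟨i + 1, h⟩ (r := (x ⟨i, hlt⟩).1.1)
      (c := (x ⟨i, hlt⟩).1.2 + 1) h1.le h2
    have h4 : (⟨i, hlt⟩ : Fin n) < p := hx.1 _ _ hp1.symm (by omega)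
    have h5 : p < ⟨i + 1, h⟩ := hx.1 _ _ (by omega) (by omega)
    have h6 : i < p.val := h4
    have h7 : p.val < i + 1 := h5
    omega
  · intro k l h1 h2
    by_contra hkl
    have h3 := hx.2 _ _ h1 h2
    obtain ⟨e1, e2⟩ := aux k l h3 hkl
    simp only [exch, Equiv.trans_apply, e1, e2] at h1 h2
    obtain ⟨p, hp1, hp2⟩ := exists_entry x ⟨i + 1, h⟩ (r := (x ⟨i, hlt⟩).1.1 + 1)
      (c := (x ⟨i, hlt⟩).1.2) h2 h1.le
    have h4 : (⟨i, hlt⟩ : Fin n) < p := hx.2 _ _ hp2.symm (by omega)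
    have h5 : p < ⟨i + 1, h⟩ := hx.2 _ _ (by omega) (by omega)
    have h6 : i < p.val := h4
    have h7 : p.val < i + 1 := h5
    omega

theorem content_exch (x : Fin n ≃ μ.cells) (i : ℕ) (h : i + 1 < n) (k : Fin n) :
    content (exch x i h) k = content x (CoxeterExtension.adj i h k) := rfl

theorem exch_exch (x : Fin n ≃ μ.cells) (i : ℕ) (h : i + 1 < n) :
    exch (exch x i h) i h = x := by
  ext k : 1
  exact congrArg x (congrArg (fun g : Equiv.Perm (Fin n) => g k)
    (CoxeterExtension.adj_mul_self h))

theorem adj_left {i : ℕ} (h : i + 1 < n) (h' : i < n) :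
    CoxeterExtension.adj i h ⟨i, h'⟩ = ⟨i + 1, h⟩ := Equiv.swap_apply_left _ _

theorem adj_right {i : ℕ} (h : i + 1 < n) :
    CoxeterExtension.adj i h ⟨i + 1, h⟩ = ⟨i, Nat.lt_of_succ_lt h⟩ := Equiv.swap_apply_right _ _

theorem axial_exch (x : Fin n ≃ μ.cells) (i : ℕ) (h : i + 1 < n) :
    axial (exch x i h) i h = - axial x i h := by
  simp only [axial, content_exch, adj_left, adj_right]
  ring

open Classical in
/-- The basis vector of a filling; zero if the filling is not standard. -/
noncomputable def vec (x : Fin n ≃ μ.cells) : StdTableau n μ → ℝ :=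
  fun S => if S.cell = x then 1 else 0

theorem isStd (T : StdTableau n μ) : IsStd T.cell := ⟨T.row_lt, T.col_lt⟩

theorem vec_of_not_std {x : Fin n ≃ μ.cells} (hx : ¬ IsStd x) : vec x = 0 := by
  funext S
  have : S.cell ≠ x := fun e => hx (e ▸ S.isStd)
  simp [vec, this]

noncomputable def ca (x : Fin n ≃ μ.cells) (i : ℕ) (h : i + 1 < n) : ℝ := 1 / (axial x i h : ℝ)
noncomputable def cb (x : Fin n ≃ μ.cells) (i : ℕ) (h : i + 1 < n) : ℝ :=
  √(1 - 1 / (axial x i h : ℝ) ^ 2)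

theorem exch_ne (x : Fin n ≃ μ.cells) (i : ℕ) (h : i + 1 < n) : exch x i h ≠ x := by
  intro e
  have := congrArg (fun y : Fin n ≃ μ.cells => y ⟨i, Nat.lt_of_succ_lt h⟩) e
  simp only [exch, Equiv.trans_apply, adj_left] at this
  have := x.injective this
  simp at this

theorem youngMatrix_vec (i : ℕ) (h : i + 1 < n) (x : Fin n ≃ μ.cells) :
    (youngMatrix n μ i h).mulVec (vec x) = ca x i h • vec x + cb x i h • vec (exch x i h) := by
  classical
  by_cases hx : IsStd x
  · obtain ⟨T, rfl⟩ : ∃ T : StdTableau n μ, T.cell = x := ⟨⟨x, hx.1, hx.2⟩, rfl⟩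
    have e : vec T.cell = Pi.single T (1 : ℝ) := by
      funext S
      simp only [vec, Pi.single_apply]
      exact if_congr ⟨fun h => StdTableau.ext h, fun h => h ▸ rfl⟩ rfl rfl
    funext S
    rw [e, Matrix.mulVec_single_one]
    simp only [Matrix.col_apply, youngMatrix, Matrix.of_apply, Pi.add_apply, Pi.smul_apply,
      smul_eq_mul, vec, Pi.single_apply]
    by_cases hS : S = T
    · subst hS
      have := exch_ne S.cell i h
      simp [ca, this.symm]
    · simp [hS, cb]
  · rw [vec_of_not_std hx]
    by_cases hs : IsStd (exch x i h)
    · have hb : cb x i h = 0 := by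
        have hns : ¬ IsStd (exch (exch x i h) i h) := by rwa [exch_exch]
        have := axial_of_not_std hs hns
        rw [axial_exch] at this
        have h2 : (axial x i h : ℝ) ^ 2 = 1 := by
          have : axial x i h ^ 2 = 1 := by
            rcases this with e | e
            · rw [show axial x i h = -1 by omega]; norm_num
            · rw [show axial x i h = 1 by omega]; norm_num
          exact_mod_cast this
        simp [cb, h2]
      simp [hb]
    · simp [vec_of_not_std hs]

theorem matrix_ext {A B : Matrix (StdTableau n μ) (StdTableau n μ) ℝ}
    (h : ∀ x : Fin n ≃ μ.cells, IsStd x → A.mulVec (vec x) = B.mulVec (vec x)) : A = B := by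
  classical
  ext S T
  have e : vec T.cell = Pi.single T (1 : ℝ) := by
    funext S
    simp only [vec, Pi.single_apply]
    exact if_congr ⟨fun h => StdTableau.ext h, fun h => h ▸ rfl⟩ rfl rfl
  have := congrFun (h T.cell T.isStd) S
  rwa [e, Matrix.mulVec_single_one, Matrix.mulVec_single_one] at this

theorem ca_exch (x : Fin n ≃ μ.cells) (i : ℕ) (h : i + 1 < n) :
    ca (exch x i h) i h = - ca x i h := by
  rw [ca, ca, axial_exch, Int.cast_neg, div_neg]

theorem cb_exch (x : Fin n ≃ μ.cells) (i : ℕ) (h : i + 1 < n) :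
    cb (exch x i h) i h = cb x i h := by
  simp [cb, axial_exch]

theorem cb_sq_of_ne {d : ℤ} (hd : d ≠ 0) :
    √(1 - 1 / (d : ℝ) ^ 2) * √(1 - 1 / (d : ℝ) ^ 2) = 1 - 1 / (d : ℝ) ^ 2 := by
  apply Real.mul_self_sqrt
  have h1 : (1 : ℝ) ≤ (d : ℝ) ^ 2 := by
    have : (1 : ℤ) ≤ d ^ 2 := by
      have := sq_pos_of_ne_zero (a := d) hd
      omega
    exact_mod_cast this
  have : 1 / (d : ℝ) ^ 2 ≤ 1 := by
    rw [div_le_one (by linarith)]; exact h1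
  linarith

theorem axial_ne {x : Fin n ≃ μ.cells} (hx : IsStd x) (i : ℕ) (h : i + 1 < n) :
    axial x i h ≠ 0 := by
  have := content_ne hx (k := ⟨i, Nat.lt_of_succ_lt h⟩) (l := ⟨i + 1, h⟩) (by simp) (by simp)
  unfold axial
  omega

theorem young_sq (i : ℕ) (h : i + 1 < n) :
    youngMatrix n μ i h * youngMatrix n μ i h = 1 := by
  refine matrix_ext fun x hx => ?_
  rw [← Matrix.mulVec_mulVec, youngMatrix_vec, Matrix.mulVec_add, Matrix.mulVec_smul,
    Matrix.mulVec_smul, youngMatrix_vec, youngMatrix_vec, exch_exch, ca_exch, cb_exch,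
    Matrix.one_mulVec]
  have hb : cb x i h * cb x i h = 1 - ca x i h ^ 2 := by
    unfold cb ca
    rw [cb_sq_of_ne (axial_ne hx i h)]
    ring
  funext S
  simp only [Pi.add_apply, Pi.smul_apply, smul_eq_mul]
  linear_combination vec x S * hb

theorem exch_comm (x : Fin n ≃ μ.cells) {i j : ℕ} (hi : i + 1 < n) (hj : j + 1 < n)
    (hij : i + 1 < j) : exch (exch x i hi) j hj = exch (exch x j hj) i hi := by
  ext k : 1
  exact congrArg x (congrArg (fun g : Equiv.Perm (Fin n) => g k)
    (CoxeterExtension.adj_comm hi hj hij))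

theorem exch_braid (x : Fin n ≃ μ.cells) {i : ℕ} (h : i + 1 < n) (h' : i + 1 + 1 < n) :
    exch (exch (exch x i h) (i + 1) h') i h =
      exch (exch (exch x (i + 1) h') i h) (i + 1) h' := by
  ext k : 1
  exact congrArg x (congrArg (fun g : Equiv.Perm (Fin n) => g k)
    (CoxeterExtension.adj_braid h h'))

theorem axial_exch_far (x : Fin n ≃ μ.cells) {i j : ℕ} (hi : i + 1 < n) (hj : j + 1 < n)
    (hij : i + 1 < j ∨ j + 1 < i) : axial (exch x i hi) j hj = axial x j hj := by
  simp only [axial, content_exch]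
  rw [CoxeterExtension.adj_of_lt hi, CoxeterExtension.adj_of_lt hi] <;> simp <;> omega

theorem young_comm (i j : ℕ) (hi : i + 1 < n) (hj : j + 1 < n) (hij : i + 1 < j) :
    youngMatrix n μ i hi * youngMatrix n μ j hj = youngMatrix n μ j hj * youngMatrix n μ i hi := by
  refine matrix_ext fun x _ => ?_
  simp only [← Matrix.mulVec_mulVec, youngMatrix_vec, Matrix.mulVec_add, Matrix.mulVec_smul,
    exch_comm x hi hj hij]
  simp only [ca, cb, axial_exch_far x hi hj (Or.inl hij), axial_exch_far x hj hi (Or.inr hij)]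
  funext S
  simp only [Pi.add_apply, Pi.smul_apply, smul_eq_mul]
  ring

theorem young_braid (i : ℕ) (h : i + 1 < n) (h' : i + 1 + 1 < n) :
    youngMatrix n μ i h * youngMatrix n μ (i + 1) h' * youngMatrix n μ i h =
      youngMatrix n μ (i + 1) h' * youngMatrix n μ i h * youngMatrix n μ (i + 1) h' := by
  refine matrix_ext fun x hx => ?_
  have hlt : i < n := Nat.lt_of_succ_lt h
  set a := content x ⟨i, hlt⟩ with ha
  set b := content x ⟨i + 1, h⟩ with hb
  set c := content x ⟨i + 1 + 1, h'⟩ with hc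
  have hab : b - a ≠ 0 := by
    have := content_ne hx (k := ⟨i, hlt⟩) (l := ⟨i + 1, h⟩) (by simp) (by simp)
    omega
  have hbc : c - b ≠ 0 := by
    have := content_ne hx (k := ⟨i + 1, h⟩) (l := ⟨i + 1 + 1, h'⟩) (by simp) (by simp)
    omega
  have hac : c - a ≠ 0 := by
    have := content_ne hx (k := ⟨i, hlt⟩) (l := ⟨i + 1 + 1, h'⟩) (by simp only; omega) (by simp only; omega)
    omega
  have fix1 : CoxeterExtension.adj i h ⟨i + 1 + 1, h'⟩ = ⟨i + 1 + 1, h'⟩ :=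
    CoxeterExtension.adj_of_lt h _ (by simp only; omega) (by simp)
  have fix2 : CoxeterExtension.adj (i + 1) h' ⟨i, hlt⟩ = ⟨i, hlt⟩ :=
    CoxeterExtension.adj_of_lt h' _ (by simp) (by simp only; omega)
  simp only [← Matrix.mulVec_mulVec, youngMatrix_vec, Matrix.mulVec_add, Matrix.mulVec_smul,
    exch_exch, exch_braid]
  simp only [ca, cb, axial, content_exch, adj_left, adj_right, fix1, fix2, ← ha, ← hb, ← hc]
  have s1 := cb_sq_of_ne hab
  have s2 := cb_sq_of_ne hbc
  have s3 := cb_sq_of_ne hac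
  have r1 : a - b = -(b - a) := by ring
  have r2 : b - c = -(c - b) := by ring
  simp only [r1, r2, Int.cast_neg, neg_sq]
  have hA : ((b - a : ℤ) : ℝ) ≠ 0 := by exact_mod_cast hab
  have hB : ((c - b : ℤ) : ℝ) ≠ 0 := by exact_mod_cast hbc
  have hC : ((c - a : ℤ) : ℝ) ≠ 0 := by exact_mod_cast hac
  have hABC : ((c - a : ℤ) : ℝ) = ((b - a : ℤ) : ℝ) + ((c - b : ℤ) : ℝ) := by push_cast; ring
  have hrel : 1 / ((b - a : ℤ) : ℝ) * (1 / ((c - b : ℤ) : ℝ)) =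
      1 / ((c - a : ℤ) : ℝ) * (1 / ((b - a : ℤ) : ℝ) + 1 / ((c - b : ℤ) : ℝ)) := by
    field_simp
    rw [hABC]; ring
  simp only [div_neg, ← one_div_pow] at s1 s2 s3 ⊢
  generalize 1 / ((b - a : ℤ) : ℝ) = A at *
  generalize 1 / ((c - b : ℤ) : ℝ) = B at *
  generalize 1 / ((c - a : ℤ) : ℝ) = C at *
  generalize √(1 - A ^ 2) = X at *
  generalize √(1 - B ^ 2) = Y at *
  generalize √(1 - C ^ 2) = Z at *
  funext S
  simp only [Pi.add_apply, Pi.smul_apply, smul_eq_mul]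
  linear_combination vec x S * (C * (s1 - s2) + (A - B) * hrel) +
    vec (exch x i h) S * X * hrel - vec (exch x (i + 1) h') S * Y * hrel

/-- There is exactly one representation of the symmetric group with Young's matrices as the images
of the adjacent transpositions. -/
theorem existsUnique_youngOrthogonal (n : ℕ) (μ : YoungDiagram) :
    ∃! ρ : Equiv.Perm (Fin n) →* Matrix (StdTableau n μ) (StdTableau n μ) ℝ,
      ∀ i h, ρ (CoxeterExtension.adj i h) = youngMatrix n μ i h := by
  obtain ⟨ρ, hρ⟩ := CoxeterExtension.exists_hom (M := fun i h => youngMatrix n μ i h)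
    (fun i h => young_sq i h) (fun i j hi hj hij => young_comm i j hi hj hij)
    (fun i h h' => young_braid i h h')
  refine ⟨ρ, hρ, fun σ hσ => ?_⟩
  rcases n with _ | n
  · ext1 g
    rw [Subsingleton.elim g 1, map_one, map_one]
  · refine MonoidHom.eq_of_eqOn_denseM (Equiv.Perm.mclosure_swap_castSucc_succ n) ?_
    rintro _ ⟨i, rfl⟩
    exact (hσ i.val (by omega)).trans (hρ i.val (by omega)).symm

end StdTableau

/-- The Young orthogonal representation of shape `μ`, as a real matrix representation on the
standard Young tableaux of shape `μ`. -/
noncomputable def youngOrthogonal (n : ℕ) (μ : YoungDiagram) :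
    Equiv.Perm (Fin n) →* Matrix (StdTableau n μ) (StdTableau n μ) ℝ :=
  (StdTableau.existsUnique_youngOrthogonal n μ).choose

theorem youngOrthogonal_adj (n : ℕ) (μ : YoungDiagram) (i : ℕ) (h : i + 1 < n) :
    youngOrthogonal n μ (CoxeterExtension.adj i h) = StdTableau.youngMatrix n μ i h :=
  (StdTableau.existsUnique_youngOrthogonal n μ).choose_spec.1 i h

/-! ### The Fourier transform -/

/-- The copy of `S_k` in `S_n` that permutes the first `k` points and fixes the others. -/
def firstPerms (n k : ℕ) : Subgroup (Equiv.Perm (Fin n)) :=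
  fixingSubgroup (Equiv.Perm (Fin n)) {i : Fin n | k ≤ i.val}

/-- The Fourier coefficient `1/|S_n| ∑_g f(g) ρ_μ(g)` of a function on `S_n`. -/
noncomputable def symFourier {n : ℕ} (f : Equiv.Perm (Fin n) → ℂ) (μ : YoungDiagram) :
    Matrix (StdTableau n μ) (StdTableau n μ) ℂ :=
  (1 / (Fintype.card (Equiv.Perm (Fin n)) : ℂ)) •
    ∑ g : Equiv.Perm (Fin n), f g • (youngOrthogonal n μ g).map (fun r : ℝ => (r : ℂ))

/-- The Fourier coefficient of a function on the left cosets of `S_k` in `S_n`, regarded as a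
right `S_k`-invariant function on `S_n`. -/
noncomputable def cosetFourier {n k : ℕ} (f : Equiv.Perm (Fin n) ⧸ firstPerms n k → ℂ)
    (μ : YoungDiagram) : Matrix (StdTableau n μ) (StdTableau n μ) ℂ :=
  symFourier (fun g => f (QuotientGroup.mk g)) μ

/-- The shapes `(n)`, `(n-1,1)`, `(n-2,2)`, `(n-2,1,1)`, as far as they are partitions. -/
def Lam (n : ℕ) : Set YoungDiagram :=
  {μ | μ.rowLens = [n] ∨ μ.rowLens = [n - 1, 1] ∨ μ.rowLens = [n - 2, 2] ∨
    μ.rowLens = [n - 2, 1, 1]}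

/-- The standard tableaux whose first `n - 2` entries all lie in the first row. -/
def patternColumns (n : ℕ) (μ : YoungDiagram) : Set (StdTableau n μ) :=
  {T | ∀ k : Fin n, k.val < n - 2 → (T.cell k).1.1 = 0}

/-! ### Tableaux and their row functions -/

namespace YoungDiagram

/-! Right invariance of `f` under `S_{n-2}` gives `M * ρ(h) = M` for `M` the transform and `h` in
`S_{n-2}` (`cosetFourier_mul`). Young's basis is adapted to the chain of the `S_k`, so `M` should
kill every basis vector whose first `n - 2` entries form a tableau with more than one row. The
argument is elementary and avoids the branching rule. Entries are numbered from `0`.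

If `k + 1` is the first entry off the first row, it lies in the box `(1, 0)`, so the axial distance
`d` from `k` is negative. Young's formula and the invariance under the exchange `s_k` give `M v_T =
(1/d) M v_T + √(1 - 1/d²) M v_{T'}`, where in `T'` the first entry off the first row has become `k`.
Induction kills the last term, and `1/d ≠ 1` kills `M v_T` (`mulVec_vec_eq_zero`). A tableau
surviving this has first row of length at least `n - 2`, which leaves only the four shapes.

Conversely, if the first `n - 2` entries lie in the first row, all axial distances among them are
`1`, so `S_{n-2}` fixes `v_T`. The indicator of the trivial coset then has a non-zero diagonal entry
at every such `T`, for all shapes at once.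

For the sizes, a standard tableau is determined by the rows of its entries (`ext_row`), and every
admissible row function occurs (`exists_of_row`). So it suffices to count the possible sets of at
most two entries outside the first row. -/

theorem rowLen_eq_getD (μ : YoungDiagram) (i : ℕ) : μ.rowLen i = μ.rowLens.getD i 0 := by
  by_cases h : i < μ.rowLens.length
  · rw [List.getD_eq_getElem _ _ h]
    exact (get_rowLens (h := h)).symm
  · rw [List.getD_eq_default _ _ (not_lt.1 h)]
    rw [length_rowLens] at h
    by_contra h0
    exact h (mem_iff_lt_colLen.1 (mem_iff_lt_rowLen.2 (Nat.pos_of_ne_zero h0)))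

theorem sum_rowLens (μ : YoungDiagram) : μ.rowLens.sum = μ.card := by
  have h : ∀ c ∈ μ.cells, c.1 ∈ Finset.range (μ.colLen 0) := fun c hc =>
    Finset.mem_range.2 (mem_iff_lt_colLen.1 (μ.up_left_mem le_rfl (Nat.zero_le _) hc))
  rw [YoungDiagram.card, Finset.card_eq_sum_card_fiberwise h, rowLens, ← List.sum_toFinset _
    List.nodup_range, List.toFinset_range]
  refine Finset.sum_congr rfl fun i _ => ?_
  rw [rowLen_eq_card, row]

end YoungDiagram

namespace StdTableau

variable {n : ℕ} {μ : YoungDiagram}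

theorem card_eq (T : StdTableau n μ) : μ.card = n := by
  have := Fintype.card_congr T.cell
  simpa [YoungDiagram.card] using this.symm

/-- The column of an entry is the number of smaller entries in its row. -/
theorem col_eq_card {x : Fin n ≃ μ.cells} (hx : IsStd x) (k : Fin n) :
    (x k).1.2 = (Finset.univ.filter fun l => l < k ∧ (x l).1.1 = (x k).1.1).card := by
  rw [← Finset.card_range (x k).1.2]
  have : Finset.range (x k).1.2 =
      (Finset.univ.filter fun l => l < k ∧ (x l).1.1 = (x k).1.1).image fun l => (x l).1.2 := by
    ext c
    simp only [Finset.mem_range, Finset.mem_image, Finset.mem_filter, Finset.mem_univ, true_and]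
    constructor
    · intro hc
      obtain ⟨m, h1, h2⟩ := exists_entry x k le_rfl hc.le
      exact ⟨m, ⟨hx.1 _ _ h1 (by omega), h1⟩, h2⟩
    · rintro ⟨l, ⟨h1, h2⟩, rfl⟩
      by_contra hc
      rcases (not_lt.1 hc).eq_or_lt with h | h
      · exact h1.ne (cell_eq_iff x h2 h.symm)
      · exact lt_asymm h1 (hx.1 _ _ h2.symm h)
  rw [this, Finset.card_image_of_injOn]
  intro l hl m hm h
  simp only [Finset.coe_filter, Finset.mem_univ, true_and, Set.mem_ofPred_eq] at hl hm
  exact cell_eq_iff x (hl.2.trans hm.2.symm) h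

/-- A standard tableau is determined by the rows of its entries. -/
theorem ext_row {T T' : StdTableau n μ} (h : ∀ k, (T.cell k).1.1 = (T'.cell k).1.1) : T = T' := by
  refine StdTableau.ext (Equiv.ext fun k => Subtype.ext (Prod.ext (h k) ?_))
  rw [col_eq_card T.isStd, col_eq_card T'.isStd]
  simp only [h]

/-- A row function with at most `μ.rowLen i` values `i` which satisfies the lattice condition comes
from a standard tableau. -/
theorem exists_of_row (hμ : μ.card = n) (r : Fin n → ℕ)
    (hr : ∀ k, (Finset.univ.filter fun l => l < k ∧ r l = r k).card < μ.rowLen (r k))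
    (hlat : ∀ k, ∀ i < r k, (Finset.univ.filter fun l => l < k ∧ r l = r k).card <
      (Finset.univ.filter fun l => l < k ∧ r l = i).card) :
    ∃ T : StdTableau n μ, ∀ k, (T.cell k).1.1 = r k := by
  -- By `col_eq_card` the column is forced: it counts the earlier entries of the same row.
  let c : Fin n → ℕ := fun k => (Finset.univ.filter fun l => l < k ∧ r l = r k).card
  have cmono : ∀ k l, r k = r l → k < l → c k < c l := by
    intro k l h hkl
    refine Finset.card_lt_card (Finset.ssubset_iff.2 ⟨k, by simp, ?_⟩)
    intro m hm
    simp only [Finset.mem_insert, Finset.mem_filter, Finset.mem_univ, true_and] at hm ⊢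
    rcases hm with rfl | ⟨h1, h2⟩
    · exact ⟨hkl, h⟩
    · exact ⟨h1.trans hkl, h2.trans h⟩
  let e : Fin n → μ.cells := fun k => ⟨(r k, c k), YoungDiagram.mem_iff_lt_rowLen.2 (hr k)⟩
  have inj : Function.Injective e := by
    intro k l h
    have h' := congrArg Subtype.val h
    have h1 : r k = r l := congrArg Prod.fst h'
    have h2 : c k = c l := congrArg Prod.snd h'
    rcases lt_trichotomy k l with hkl | hkl | hkl
    · exact absurd h2 (cmono k l h1 hkl).ne
    · exact hkl
    · exact absurd h2 (cmono l k h1.symm hkl).ne'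
  have bij : Function.Bijective e := by
    rw [Fintype.bijective_iff_injective_and_card]
    exact ⟨inj, by simpa [YoungDiagram.card] using hμ.symm⟩
  refine ⟨⟨Equiv.ofBijective e bij, ?_, ?_⟩, fun k => rfl⟩
  · intro k l (h1 : r k = r l) (h2 : c k < c l)
    by_contra h
    rcases (not_lt.1 h).eq_or_lt with h | h
    · subst h; exact lt_irrefl _ h2
    · exact lt_asymm h2 (cmono l k h1.symm h)
  · intro k l (h1 : c k = c l) (h2 : r k < r l)
    by_contra h
    -- If `l ≤ k`, the lattice condition at `l` gives `c l < c k`, although the columns agree.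
    have h3 : c l < (Finset.univ.filter fun m => m < l ∧ r m = r k).card := hlat l (r k) h2
    have h4 : (Finset.univ.filter fun m => m < l ∧ r m = r k).card ≤ c k := by
      refine Finset.card_le_card fun m hm => ?_
      simp only [Finset.mem_filter, Finset.mem_univ, true_and] at hm ⊢
      exact ⟨hm.1.trans_le (not_lt.1 h), hm.2⟩
    omega

end StdTableau

/-! ### Columns outside the pattern vanish -/

theorem adj_mem_firstPerms {n k i : ℕ} (h : i + 1 < n) (hk : i + 1 < k) :
    CoxeterExtension.adj i h ∈ firstPerms n k := by
  rw [firstPerms, mem_fixingSubgroup_iff]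
  intro a ha
  have ha' : k ≤ a.val := ha
  exact CoxeterExtension.adj_of_lt h a (by omega) (by omega)

/-- Substituting `g ↦ g * h` in the sum does not change the value of `f`. The vanishing statements
use nothing else about `f`. -/
theorem cosetFourier_mul {n k : ℕ} (f : Equiv.Perm (Fin n) ⧸ firstPerms n k → ℂ)
    (μ : YoungDiagram) {h : Equiv.Perm (Fin n)} (hh : h ∈ firstPerms n k) :
    cosetFourier f μ * (youngOrthogonal n μ h).map Complex.ofRealHom = cosetFourier f μ := by
  unfold cosetFourier symFourier
  rw [Matrix.smul_mul, Finset.sum_mul]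
  congr 1
  refine Fintype.sum_equiv (Equiv.mulRight h) _ _ fun g => ?_
  simp only [Equiv.coe_mulRight]
  rw [QuotientGroup.mk_mul_of_mem _ hh, Matrix.smul_mul, map_mul]
  congr 1
  exact (Matrix.map_mul (f := Complex.ofRealHom)).symm

namespace StdTableau

variable {n : ℕ} {μ : YoungDiagram}

/-- A matrix that is invariant under the first `m` entries vanishes on a tableau in which some of
these entries is not in the first row. -/
theorem mulVec_vec_eq_zero {m : ℕ} {M : Matrix (StdTableau n μ) (StdTableau n μ) ℂ}
    (hM : ∀ i h, i + 1 < m → M * (youngMatrix n μ i h).map Complex.ofRealHom = M) (k : ℕ) :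
    ∀ (hk : k < n) (x : Fin n ≃ μ.cells), IsStd x → k < m →
      (∀ l : Fin n, l.val < k → (x l).1.1 = 0) → (x ⟨k, hk⟩).1.1 ≠ 0 →
      M.mulVec (fun S => (vec x S : ℂ)) = 0 := by
  induction k with
  | zero =>
    intro hk x hx _ _ h0
    obtain ⟨p, hp1, hp2⟩ := exists_entry x ⟨0, hk⟩ (Nat.zero_le _) le_rfl
    have : p < ⟨0, hk⟩ := hx.2 _ _ hp2 (by omega)
    exact absurd (Fin.lt_def.1 this) (Nat.not_lt_zero _)
  | succ k ih =>
    intro hk x hx hkm hlow h0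
    have hk' : k < n := Nat.lt_of_succ_lt hk
    -- The box above and the box to the left hold smaller entries, which are in row `0`; so `k + 1`
    -- sits in the box `(1, 0)`.
    have hrow : (x ⟨k + 1, hk⟩).1.1 = 1 := by
      obtain ⟨p, hp1, hp2⟩ := exists_entry x ⟨k + 1, hk⟩
        (r := (x ⟨k + 1, hk⟩).1.1 - 1) (Nat.sub_le _ _) le_rfl
      have h1 : p < ⟨k + 1, hk⟩ := hx.2 _ _ hp2 (by omega)
      have := hlow p h1
      omega
    have hcol : (x ⟨k + 1, hk⟩).1.2 = 0 := by
      by_contra hc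
      obtain ⟨p, hp1, hp2⟩ := exists_entry x ⟨k + 1, hk⟩ (r := 1) hrow.ge (Nat.zero_le _)
      have h1 : p < ⟨k + 1, hk⟩ := hx.1 _ _ (hp1.trans hrow.symm) (by omega)
      have := hlow p h1
      omega
    have hrow' : (x ⟨k, hk'⟩).1.1 = 0 := hlow _ (Nat.lt_succ_self k)
    -- The content of `k` is at least `0`, that of `k + 1` is `-1`.
    have hd : axial x k hk < 0 := by
      unfold axial content
      omega
    -- After the exchange the first entry off the first row is `k`, so the induction hypothesis
    -- applies; a non-standard filling has zero vector anyway.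
    have hex : M.mulVec (fun S => (vec (exch x k hk) S : ℂ)) = 0 := by
      by_cases hs : IsStd (exch x k hk)
      · refine ih hk' _ hs (by omega) (fun l hl => ?_) ?_
        · simp only [exch, Equiv.trans_apply]
          rw [CoxeterExtension.adj_of_lt hk l (by omega) (by omega)]
          exact hlow l (by omega)
        · simp only [exch, Equiv.trans_apply, adj_left]
          omega
      · have : (fun S => (vec (exch x k hk) S : ℂ)) = 0 := by
          rw [vec_of_not_std hs]; funext S; simp
        rw [this, Matrix.mulVec_zero]
    have key : M.mulVec (fun S => (vec x S : ℂ)) =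
        (ca x k hk : ℂ) • M.mulVec (fun S => (vec x S : ℂ)) := by
      conv_lhs => rw [← hM k hk hkm, ← Matrix.mulVec_mulVec]
      have : ((youngMatrix n μ k hk).map Complex.ofRealHom).mulVec (fun S => (vec x S : ℂ)) =
          (ca x k hk : ℂ) • (fun S => (vec x S : ℂ)) +
          (cb x k hk : ℂ) • (fun S => (vec (exch x k hk) S : ℂ)) := by
        funext S
        have e := RingHom.map_mulVec Complex.ofRealHom (youngMatrix n μ k hk) (vec x) S
        rw [youngMatrix_vec] at e
        refine e.symm.trans ?_
        simp
      rw [this, Matrix.mulVec_add, Matrix.mulVec_smul, Matrix.mulVec_smul, hex, smul_zero, add_zero]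
    have hca : (1 - ca x k hk : ℂ) ≠ 0 := by
      have h1 : ca x k hk < 0 := by
        unfold ca
        exact one_div_neg.2 (by exact_mod_cast hd)
      have h2 : (1 - ca x k hk : ℝ) ≠ 0 := by linarith
      exact_mod_cast h2
    refine (smul_eq_zero.1 ?_).resolve_left hca
    rw [sub_smul, one_smul, ← key, sub_self]

theorem vec_cell (T : StdTableau n μ) : vec T.cell = Pi.single T (1 : ℝ) := by
  funext S
  simp only [vec, Pi.single_apply]
  exact if_congr ⟨fun h => StdTableau.ext h, fun h => h ▸ rfl⟩ rfl rfl

end StdTableau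

theorem cosetFourier_apply_eq_zero {n : ℕ} (f : Equiv.Perm (Fin n) ⧸ firstPerms n (n - 2) → ℂ)
    (μ : YoungDiagram) {T : StdTableau n μ} (hT : T ∉ patternColumns n μ) (S : StdTableau n μ) :
    cosetFourier f μ S T = 0 := by
  have hex : ∃ k, ∃ hk : k < n, k < n - 2 ∧ (T.cell ⟨k, hk⟩).1.1 ≠ 0 := by
    by_contra! h
    exact hT fun k hk => h k k.2 hk
  classical
  -- Minimality of this entry puts all smaller entries in the first row, as the induction requires.
  obtain ⟨hk, hk2, h0⟩ := Nat.find_spec hex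
  have := StdTableau.mulVec_vec_eq_zero (m := n - 2) (M := cosetFourier f μ)
    (fun i h hi => by
      rw [← youngOrthogonal_adj]; exact cosetFourier_mul f μ (adj_mem_firstPerms h hi))
    _ hk T.cell T.isStd hk2 (fun l hl => by
      by_contra h
      exact Nat.find_min hex hl ⟨l.2, by omega, h⟩) h0
  have e : (fun S => (StdTableau.vec T.cell S : ℂ)) = Pi.single T 1 := by
    rw [StdTableau.vec_cell]
    funext S
    by_cases h : S = T <;> simp [h]
  rw [e, Matrix.mulVec_single_one] at this
  exact congrFun this S

/-! ### Shapes with a tableau in the pattern -/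

theorem col_of_mem_patternColumns {n : ℕ} {μ : YoungDiagram} {T : StdTableau n μ}
    (hT : T ∈ patternColumns n μ) {k : Fin n} (hk : k.val < n - 2) : (T.cell k).1.2 = k.val := by
  rw [StdTableau.col_eq_card T.isStd, hT k hk]
  have : (Finset.univ.filter fun l : Fin n => l < k ∧ (T.cell l).1.1 = 0) = Finset.Iio k := by
    ext l
    simp only [Finset.mem_filter, Finset.mem_univ, true_and, Finset.mem_Iio,
      and_iff_left_iff_imp, Fin.lt_def]
    exact fun hl => hT l (by omega)
  rw [this, Fin.card_Iio]

/-- The first row contains `n - 2` entries, so at most two boxes remain for the other rows.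
Positivity of the row lengths and their sum `n` then suffice. -/
theorem mem_Lam_of_mem_patternColumns {n : ℕ} (hn : 3 ≤ n) {μ : YoungDiagram}
    {T : StdTableau n μ} (hT : T ∈ patternColumns n μ) : μ ∈ Lam n := by
  have h0 : n - 2 ≤ μ.rowLen 0 := by
    -- The largest of the first `n - 2` entries is `n - 3`; it exists because `3 ≤ n`, and it
    -- occupies column `n - 3`.
    have hk : n - 3 < n := by omega
    have h1 := hT ⟨n - 3, hk⟩ (by simp only; omega)
    have h2 : (T.cell ⟨n - 3, hk⟩).1.2 = n - 3 :=
      col_of_mem_patternColumns hT (by simp only; omega)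
    have h3 : (0, n - 3) ∈ μ := by
      have : (((T.cell ⟨n - 3, hk⟩).1.1, (T.cell ⟨n - 3, hk⟩).1.2) : ℕ × ℕ) ∈ μ :=
        (T.cell ⟨n - 3, hk⟩).2
      rwa [h1, h2] at this
    have := YoungDiagram.mem_iff_lt_rowLen.1 h3
    omega
  have hsum := μ.sum_rowLens.trans T.card_eq
  have hpos := μ.pos_of_mem_rowLens
  rw [μ.rowLen_eq_getD] at h0
  rw [Lam, Set.mem_ofPred_eq]
  rcases hw : μ.rowLens with _ | ⟨a, _ | ⟨b, _ | ⟨c, _ | ⟨d, w⟩⟩⟩⟩ <;>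
    simp only [hw, List.sum_cons, List.sum_nil, List.mem_cons, List.getD_cons_zero,
      forall_eq_or_imp, List.getD_nil] at hsum hpos h0 <;>
    simp only [List.cons.injEq, and_true, reduceCtorEq, and_false, or_false, false_or] <;> omega

theorem cosetFourier_eq_zero {n : ℕ} (hn : 3 ≤ n)
    (f : Equiv.Perm (Fin n) ⧸ firstPerms n (n - 2) → ℂ) {μ : YoungDiagram} (hμ : μ ∉ Lam n) :
    cosetFourier f μ = 0 := by
  ext S T
  exact cosetFourier_apply_eq_zero f μ (fun h => hμ (mem_Lam_of_mem_patternColumns hn h)) S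

/-! ### A function whose transform has all columns of the pattern -/

/-- Conjugating `(a b)` by `(b b+1)` gives `(a b+1)`. -/
theorem swap_mem_of_adj_mem {n k : ℕ} {H : Subgroup (Equiv.Perm (Fin n))}
    (hH : ∀ i h, i + 1 < k → CoxeterExtension.adj i h ∈ H) (a : Fin n) (b : ℕ) :
    ∀ hb : b < n, a.val < b → b < k → Equiv.swap a ⟨b, hb⟩ ∈ H := by
  induction b with
  | zero => intro _ h; omega
  | succ b ih =>
    intro hb hab hbk
    have hadj := hH b hb hbk
    by_cases h : a.val = b
    · rwa [show a = ⟨b, Nat.lt_of_succ_lt hb⟩ from Fin.ext h]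
    · have h1 := ih (Nat.lt_of_succ_lt hb) (by omega) (by omega)
      have h2 := Equiv.swap_apply_apply (CoxeterExtension.adj b hb) a ⟨b, Nat.lt_of_succ_lt hb⟩
      rw [StdTableau.adj_left, CoxeterExtension.adj_of_lt hb a h (by omega)] at h2
      rw [h2]
      exact H.mul_mem (H.mul_mem hadj h1) (H.inv_mem hadj)

/-- The adjacent transpositions generate: if `g` moves only the points up to `p`, multiplying it by
the transposition of `g p` and `p` makes it fix `p` too, and induction applies. -/
theorem firstPerms_le {n k : ℕ} {H : Subgroup (Equiv.Perm (Fin n))}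
    (hH : ∀ i h, i + 1 < k → CoxeterExtension.adj i h ∈ H) : firstPerms n k ≤ H := by
  have key : ∀ j ≤ k, ∀ g ∈ firstPerms n j, g ∈ H := by
    intro j
    induction j with
    | zero =>
      intro _ g hg
      have : g = 1 := Equiv.ext fun a => (mem_fixingSubgroup_iff _).1 hg a (Nat.zero_le _)
      rw [this]; exact one_mem _
    | succ j ih =>
      intro hj g hg
      have hfix : ∀ a : Fin n, j + 1 ≤ a.val → g a = a := fun a ha =>
        (mem_fixingSubgroup_iff _).1 hg a ha
      by_cases hjn : j < n
      swap
      · exact ih (by omega) g ((mem_fixingSubgroup_iff _).2 fun a (ha : j ≤ a.val) => by omega)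
      set p : Fin n := ⟨j, hjn⟩ with hp
      -- A value beyond `p` would be a fixed point of `g`, hence equal to `p` by injectivity.
      have hle : (g p).val ≤ j := by
        by_contra h
        have h1 : g (g p) = g p := hfix _ (by omega)
        have h2 : g p = p := g.injective h1
        rw [h2] at h
        exact h le_rfl
      have hs : Equiv.swap (g p) p ∈ H := by
        rcases hle.eq_or_lt with h | h
        · rw [show g p = p from Fin.ext h, Equiv.swap_self]; exact one_mem _
        · exact swap_mem_of_adj_mem hH (g p) j hjn h (by omega)
      have hq : Equiv.swap (g p) p * g ∈ H := by
        refine ih (by omega) _ ((mem_fixingSubgroup_iff _).2 fun a (ha : j ≤ a.val) => ?_)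
        rw [Equiv.Perm.smul_def, Equiv.Perm.mul_apply]
        rcases ha.eq_or_lt with h | h
        · rw [show a = p from Fin.ext h.symm, Equiv.swap_apply_left]
        · rw [hfix a h, Equiv.swap_apply_of_ne_of_ne] <;> intro e
          · rw [← e] at hle; omega
          · rw [e] at h; exact lt_irrefl _ h
      have := H.mul_mem (H.inv_mem hs) hq
      rwa [inv_mul_cancel_left] at this
  exact key k le_rfl

/-- Consecutive entries among the first `n - 2` are neighbours in the first row, so `d = 1`, the
diagonal entry is `1` and the square root is `0`. The stabilizer of the vector is a subgroup, so
checking these generators is enough. -/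
theorem youngOrthogonal_mulVec_vec {n : ℕ} {μ : YoungDiagram} {T : StdTableau n μ}
    (hT : T ∈ patternColumns n μ) {g : Equiv.Perm (Fin n)} (hg : g ∈ firstPerms n (n - 2)) :
    (youngOrthogonal n μ g).mulVec (StdTableau.vec T.cell) = StdTableau.vec T.cell := by
  let H : Subgroup (Equiv.Perm (Fin n)) :=
    { carrier := {g | (youngOrthogonal n μ g).mulVec (StdTableau.vec T.cell) =
        StdTableau.vec T.cell}
      mul_mem' := by
        intro a b (ha : _ = _) (hb : _ = _)
        rw [Set.mem_ofPred_eq, map_mul, ← Matrix.mulVec_mulVec, hb, ha]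
      one_mem' := by rw [Set.mem_ofPred_eq, map_one, Matrix.one_mulVec]
      inv_mem' := by
        intro a (ha : _ = _)
        rw [Set.mem_ofPred_eq]
        conv_lhs => rw [← ha]
        rw [Matrix.mulVec_mulVec, ← map_mul, inv_mul_cancel, map_one, Matrix.one_mulVec] }
  refine firstPerms_le (H := H) (fun i h hi => ?_) hg
  change (youngOrthogonal n μ _).mulVec _ = _
  have hax : StdTableau.axial T.cell i h = 1 := by
    unfold StdTableau.axial StdTableau.content
    rw [hT ⟨i + 1, h⟩ hi, hT ⟨i, _⟩ (by simp only; omega), col_of_mem_patternColumns hT hi,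
      col_of_mem_patternColumns hT (by simp only; omega)]
    push_cast
    ring
  rw [youngOrthogonal_adj, StdTableau.youngMatrix_vec]
  simp [StdTableau.ca, StdTableau.cb, hax]

/-- The indicator of the trivial coset turns the transform into a multiple of the sum of `ρ(h)` over
`S_{n-2}`. Each `h` contributes `1` at the diagonal position `(T, T)`, so this entry is `|S_{n-2}| /
n!`. -/
theorem exists_cosetFourier_ne_zero (n : ℕ) :
    ∃ f : Equiv.Perm (Fin n) ⧸ firstPerms n (n - 2) → ℂ,
      ∀ μ, ∀ T ∈ patternColumns n μ, ∃ S, cosetFourier f μ S T ≠ 0 := by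
  classical
  refine ⟨fun q => if q = QuotientGroup.mk 1 then 1 else 0, fun μ T hT => ⟨T, ?_⟩⟩
  have hone : ∀ g ∈ firstPerms n (n - 2), youngOrthogonal n μ g T T = 1 := by
    intro g hg
    have := congrFun (youngOrthogonal_mulVec_vec hT hg) T
    rw [StdTableau.vec_cell, Matrix.mulVec_single_one] at this
    simpa using this
  have hmem : ∀ g : Equiv.Perm (Fin n),
      (QuotientGroup.mk g : Equiv.Perm (Fin n) ⧸ firstPerms n (n - 2)) = QuotientGroup.mk 1 ↔
        g ∈ firstPerms n (n - 2) := by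
    intro g
    rw [eq_comm, QuotientGroup.eq, inv_one, one_mul]
  unfold cosetFourier symFourier
  rw [Matrix.smul_apply, Matrix.sum_apply, smul_eq_mul]
  refine mul_ne_zero (by simp) ?_
  have : ∀ g : Equiv.Perm (Fin n),
      ((if (QuotientGroup.mk g : Equiv.Perm (Fin n) ⧸ firstPerms n (n - 2)) = QuotientGroup.mk 1
        then (1 : ℂ) else 0) • (youngOrthogonal n μ g).map (fun r : ℝ => (r : ℂ))) T T =
      if g ∈ firstPerms n (n - 2) then 1 else 0 := by
    intro g
    rw [Matrix.smul_apply, Matrix.map_apply]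
    by_cases hg : g ∈ firstPerms n (n - 2)
    · simp [hmem, hg, hone g hg]
    · simp [hmem, hg]
  rw [Finset.sum_congr rfl fun g _ => this g, Finset.sum_boole]
  exact Nat.cast_ne_zero.2 (Finset.card_ne_zero.2 ⟨1, by simp [one_mem]⟩)

/-! ### Counting tableaux -/

namespace StdTableau

variable {n : ℕ} {μ : YoungDiagram}

/-- Counting standard tableaux, and those in the pattern, by their row functions. -/
theorem card_and_ncard_of_rows {ι : Type*} (R : ι → Fin n → ℕ) (s t : Finset ι) (hts : t ⊆ s)
    (hinj : ∀ i ∈ s, ∀ j ∈ s, R i = R j → i = j)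
    (hex : ∀ i ∈ s, ∃ T : StdTableau n μ, ∀ k, (T.cell k).1.1 = R i k)
    (hsurj : ∀ T : StdTableau n μ, ∃ i ∈ s, ∀ k, (T.cell k).1.1 = R i k)
    (ht : ∀ i ∈ s, (∀ k : Fin n, k.val < n - 2 → R i k = 0) ↔ i ∈ t) :
    Fintype.card (StdTableau n μ) = s.card ∧ (patternColumns n μ).ncard = t.card := by
  choose F hF using hex
  have Finj : ∀ i hi j hj, F i hi = F j hj → i = j := fun i hi j hj h =>
    hinj i hi j hj (funext fun k => by rw [← hF i hi k, ← hF j hj k, h])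
  have Fsurj : ∀ T, ∃ i, ∃ hi : i ∈ s, F i hi = T := fun T => by
    obtain ⟨i, hi, h⟩ := hsurj T
    exact ⟨i, hi, ext_row fun k => by rw [hF i hi k, h k]⟩
  constructor
  · exact (Finset.card_bij F (fun _ _ => Finset.mem_univ _) Finj
      fun T _ => Fsurj T).symm
  · rw [← Set.ncard_coe_finset]
    refine (Set.ncard_congr (fun i hi => F i (hts hi)) ?_ ?_ ?_).symm
    · intro i hi k hk
      rw [hF]
      exact (ht i (hts hi)).2 hi k hk
    · intro i j hi hj h
      exact Finj _ _ _ _ h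
    · intro T hT
      obtain ⟨i, hi, rfl⟩ := Fsurj T
      exact ⟨i, (ht i hi).1 fun k hk => by rw [← hF i hi k]; exact hT k hk, rfl⟩

/-- A version of `exists_of_row` that bounds the total number of entries in each row. -/
theorem exists_of_row_le (hμ : μ.card = n) (r : Fin n → ℕ)
    (hr : ∀ k, (Finset.univ.filter fun l => r l = r k).card ≤ μ.rowLen (r k))
    (hlat : ∀ k, ∀ i < r k, (Finset.univ.filter fun l => l < k ∧ r l = r k).card <
      (Finset.univ.filter fun l => l < k ∧ r l = i).card) :
    ∃ T : StdTableau n μ, ∀ k, (T.cell k).1.1 = r k := by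
  -- The entry `k` itself belongs to its row, so the earlier entries of that row are strictly fewer.
  refine exists_of_row hμ r (fun k => lt_of_lt_of_le (Finset.card_lt_card ?_) (hr k)) hlat
  refine Finset.ssubset_iff.2 ⟨k, by simp, fun l hl => ?_⟩
  simp only [Finset.mem_insert, Finset.mem_filter, Finset.mem_univ, true_and] at hl ⊢
  rcases hl with rfl | h
  · rfl
  · exact h.2

theorem lt_rowLen (T : StdTableau n μ) (k : Fin n) : (T.cell k).1.2 < μ.rowLen (T.cell k).1.1 :=
  YoungDiagram.mem_iff_lt_rowLen.1 (T.cell k).2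

theorem exists_cell_eq (T : StdTableau n μ) {i j : ℕ} (h : j < μ.rowLen i) :
    ∃ a : Fin n, (T.cell a).1.1 = i ∧ (T.cell a).1.2 = j :=
  ⟨T.cell.symm ⟨(i, j), YoungDiagram.mem_iff_lt_rowLen.2 h⟩, by simp, by simp⟩

/-- An entry outside the first row is positive. -/
theorem pos_of_row_ne_zero (T : StdTableau n μ) {a : Fin n} (h : (T.cell a).1.1 ≠ 0) :
    1 ≤ a.val := by
  obtain ⟨p, hp1, hp2⟩ := exists_entry T.cell a (Nat.zero_le _) le_rfl
  have h1 : p < a := T.col_lt _ _ hp2 (by omega)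
  have h2 : p.val < a.val := h1
  omega

/-! ### The shapes with at most one box below the first row -/

theorem card_row (hμ : μ.rowLens = [n]) :
    Fintype.card (StdTableau n μ) = 1 ∧ (patternColumns n μ).ncard = 1 := by
  have hcard : μ.card = n := by rw [← μ.sum_rowLens, hμ]; simp
  have h0 : μ.rowLen 0 = n := by rw [μ.rowLen_eq_getD, hμ]; rfl
  have h1 : ∀ i, μ.rowLen (i + 1) = 0 := fun i => by rw [μ.rowLen_eq_getD, hμ]; rfl
  refine card_and_ncard_of_rows (fun _ _ => 0) {()} {()} subset_rfl (by simp) ?_ ?_ (by simp)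
  · intro _ _
    refine exists_of_row_le hcard _ (fun k => ?_) (by simp)
    simp [h0]
  · intro T
    refine ⟨(), by simp, fun k => ?_⟩
    have := T.lt_rowLen k
    rcases hrow : (T.cell k).1.1 with _ | i
    · rfl
    · rw [hrow, h1] at this
      omega

/-- The tableau is given by its one entry `a` in the second row, which can be anything but `0`. The
pattern consists of `a = n - 2` and `a = n - 1`. -/
theorem card_hook_one (hn : 3 ≤ n) (hμ : μ.rowLens = [n - 1, 1]) :
    Fintype.card (StdTableau n μ) = n - 1 ∧ (patternColumns n μ).ncard = 2 := by
  have hcard : μ.card = n := by rw [← μ.sum_rowLens, hμ]; simp; omega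
  have h0 : μ.rowLen 0 = n - 1 := by rw [μ.rowLen_eq_getD, hμ]; rfl
  have h1 : μ.rowLen 1 = 1 := by rw [μ.rowLen_eq_getD, hμ]; rfl
  have h2 : ∀ i, μ.rowLen (i + 2) = 0 := fun i => by rw [μ.rowLen_eq_getD, hμ]; rfl
  have := card_and_ncard_of_rows (μ := μ) (fun a (k : Fin n) => if k.val = a then 1 else 0)
    (Finset.Ico 1 n) (Finset.Ico (n - 2) n) (Finset.Ico_subset_Ico (by omega) le_rfl)
    ?_ ?_ ?_ ?_
  · rw [Nat.card_Ico, Nat.card_Ico] at this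
    rw [this.1, this.2]
    omega
  · intro a ha b hb h
    have := congrFun h ⟨a, (Finset.mem_Ico.1 ha).2⟩
    by_contra hab
    simp [hab] at this
  · intro a ha
    obtain ⟨ha1, han⟩ := Finset.mem_Ico.1 ha
    have hone : ∀ l : Fin n, (if l.val = a then 1 else 0) = 1 ↔ l = ⟨a, han⟩ := by
      intro l; simp [Fin.ext_iff]
    have hzero : ∀ l : Fin n, (if l.val = a then 1 else 0) = 0 ↔ l ≠ ⟨a, han⟩ := by
      intro l; simp [Fin.ext_iff]
    refine exists_of_row_le hcard _ (fun k => ?_) (fun k i hi => ?_)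
    · by_cases hk : k.val = a
      · simp only [hk, if_true, hone, h1]
        rw [Finset.filter_eq']; simp
      · simp only [hk, if_false, hzero, h0]
        rw [Finset.filter_ne', Finset.card_erase_of_mem (Finset.mem_univ _)]; simp
    · obtain ⟨hk, rfl⟩ : k.val = a ∧ i = 0 := by
        split_ifs at hi with h
        · exact ⟨h, by omega⟩
        · omega
      simp only [hk, if_true]
      -- The lattice condition matters only at `a`: no earlier entry is in row `1`, while `0` is an
      -- earlier entry in row `0`.
      rw [Finset.card_eq_zero.2 (Finset.filter_eq_empty_iff.2 ?_)]
      · exact Finset.card_pos.2 ⟨⟨0, by omega⟩, by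
          simp only [Finset.mem_filter, Finset.mem_univ, true_and, Fin.lt_def]
          rw [if_neg (by omega)]
          omega⟩
      · rintro l - ⟨h1, h2⟩
        rw [hone] at h2
        rw [h2, Fin.lt_def] at h1
        simp only at h1
        omega
  · intro T
    obtain ⟨a, ha1, ha2⟩ := T.exists_cell_eq (i := 1) (j := 0) (by omega)
    refine ⟨a.val, Finset.mem_Ico.2 ⟨T.pos_of_row_ne_zero (by omega), a.2⟩, fun k => ?_⟩
    have hlt := T.lt_rowLen k
    split_ifs with hk
    · rw [Fin.ext hk, ha1]
    · rcases hrow : (T.cell k).1.1 with _ | _ | i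
      · rfl
      · rw [hrow, h1] at hlt
        exact absurd (congrArg Fin.val (cell_eq_iff T.cell (hrow.trans ha1.symm) (by omega))) hk
      · rw [hrow, h2] at hlt
        omega
  · intro a ha
    obtain ⟨ha1, han⟩ := Finset.mem_Ico.1 ha
    rw [Finset.mem_Ico]
    constructor
    · intro h
      refine ⟨?_, han⟩
      by_contra hlt
      have := h ⟨a, han⟩ (by simp only; omega)
      simp at this
    · intro h k hk
      rw [if_neg (by omega)]

/-! ### The shapes with two boxes below the first row -/

theorem sum_Ico_pred (m : ℕ) :
    2 * (∑ b ∈ Finset.Ico 1 (m + 1), (b - 1)) + m = m * m := by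
  induction m with
  | zero => simp
  | succ m ih =>
    rw [Finset.sum_Ico_succ_top (by omega)]
    simp only [Nat.add_sub_cancel]
    linarith

/-- The pairs `(b, a)` with `1 ≤ a < b < n` and `c ≤ b`. -/
def lowerPairs (n c : ℕ) : Finset (Σ _ : ℕ, ℕ) :=
  (Finset.Ico c n).sigma fun b => Finset.Ico 1 b

theorem mem_lowerPairs {n c : ℕ} {p : Σ _ : ℕ, ℕ} :
    p ∈ lowerPairs n c ↔ c ≤ p.1 ∧ p.1 < n ∧ 1 ≤ p.2 ∧ p.2 < p.1 := by
  simp [lowerPairs, and_assoc]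

theorem card_lowerPairs_one (hn : 3 ≤ n) :
    ((lowerPairs n 1).card : ℚ) = ((n : ℚ) - 1) * ((n : ℚ) - 2) / 2 := by
  obtain ⟨m, rfl⟩ : ∃ m, n = m + 1 := ⟨n - 1, by omega⟩
  have h := sum_Ico_pred m
  rw [lowerPairs, Finset.card_sigma]
  simp only [Nat.card_Ico]
  have h' : (2 : ℚ) * ((∑ b ∈ Finset.Ico 1 (m + 1), (b - 1) : ℕ) : ℚ) + m = m * m := by
    exact_mod_cast h
  push_cast [-Nat.cast_sum] at h' ⊢
  linarith

/-- Raising the lower bound on `b` from `1` to `3` discards only the pair `a = 1`, `b = 2`. -/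
theorem card_lowerPairs_three (hn : 3 ≤ n) :
    ((lowerPairs n 3).card : ℚ) = (n : ℚ) * ((n : ℚ) - 3) / 2 := by
  have h := card_lowerPairs_one hn
  have h2 : (lowerPairs n 1).card = (lowerPairs n 3).card + 1 := by
    rw [lowerPairs, lowerPairs, Finset.card_sigma, Finset.card_sigma,
      ← Finset.sum_Ico_consecutive _ (show 1 ≤ 3 by omega) hn, add_comm]
    rfl
  rw [h2] at h
  push_cast at h
  linarith

/-- The row function with value `1` at `a`, value `v` at `b` and value `0` elsewhere. -/
def twoRows (v : ℕ) (p : Σ _ : ℕ, ℕ) (k : Fin n) : ℕ :=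
  if k.val = p.2 then 1 else if k.val = p.1 then v else 0

theorem twoRows_eq_zero {v : ℕ} (hv : v ≠ 0) {p : Σ _ : ℕ, ℕ} {k : Fin n} :
    twoRows v p k = 0 ↔ k.val ≠ p.2 ∧ k.val ≠ p.1 := by
  unfold twoRows
  split_ifs <;> simp_all

/-- The zero set of the row function determines `{a, b}`, and `a < b` orders it. In the pattern both
lie outside the first `n - 2` entries, which forces `a = n - 2` and `b = n - 1`; `c < n` makes this
pair admissible. -/
theorem card_and_ncard_of_twoRows (hn : 3 ≤ n) {v c : ℕ} (hv : v ≠ 0) (hcn : c < n)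
    (hex : ∀ p ∈ lowerPairs n c, ∃ T : StdTableau n μ, ∀ k, (T.cell k).1.1 = twoRows v p k)
    (hsurj : ∀ T : StdTableau n μ, ∃ p ∈ lowerPairs n c, ∀ k, (T.cell k).1.1 = twoRows v p k) :
    Fintype.card (StdTableau n μ) = (lowerPairs n c).card ∧ (patternColumns n μ).ncard = 1 := by
  refine card_and_ncard_of_rows (twoRows v) (lowerPairs n c) {⟨n - 1, n - 2⟩} ?_ ?_ hex hsurj ?_
  · rw [Finset.singleton_subset_iff, mem_lowerPairs]
    simp only
    omega
  · rintro ⟨b, a⟩ hp ⟨b', a'⟩ hq h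
    obtain ⟨h1, h2, h3, h4⟩ := mem_lowerPairs.1 hp
    obtain ⟨h1', h2', h3', h4'⟩ := mem_lowerPairs.1 hq
    simp only at h1 h2 h3 h4 h1' h2' h3' h4'
    have hz : ∀ k : Fin n, (k.val ≠ a ∧ k.val ≠ b) ↔ (k.val ≠ a' ∧ k.val ≠ b') := fun k => by
      have e1 := twoRows_eq_zero hv (p := ⟨b, a⟩) (k := k)
      rw [h, twoRows_eq_zero hv] at e1
      exact e1.symm
    have ea := hz ⟨a, by omega⟩
    have eb := hz ⟨b, h2⟩
    have ea' := hz ⟨a', by omega⟩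
    simp only at ea eb ea'
    obtain ⟨rfl, rfl⟩ : a = a' ∧ b = b' := by omega
    rfl
  · rintro ⟨b, a⟩ hp
    obtain ⟨h1, h2, h3, h4⟩ := mem_lowerPairs.1 hp
    simp only [twoRows_eq_zero hv, Finset.mem_singleton, Sigma.mk.injEq, heq_eq_eq]
    simp only at h1 h2 h3 h4
    constructor
    · intro h
      have ha := h ⟨a, by omega⟩
      simp only at ha
      omega
    · rintro ⟨rfl, rfl⟩ k hk
      omega

/-- Few entries are missing from the first row. -/
theorem card_twoRows_eq_zero {v : ℕ} (hv : v ≠ 0) {p : Σ _ : ℕ, ℕ} (h2 : p.2 < p.1)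
    (h1 : p.1 < n) : (Finset.univ.filter fun l : Fin n => twoRows v p l = 0).card ≤ n - 2 := by
  have : (Finset.univ.filter fun l : Fin n => twoRows v p l = 0) ⊆
      (Finset.univ.erase ⟨p.1, h1⟩).erase ⟨p.2, h2.trans h1⟩ := by
    intro l hl
    simp only [Finset.mem_filter, Finset.mem_univ, true_and, twoRows_eq_zero hv] at hl
    simp [Fin.ext_iff, hl.1, hl.2]
  refine (Finset.card_le_card this).trans ?_
  rw [Finset.card_erase_of_mem (by simp [Fin.ext_iff]; omega),
    Finset.card_erase_of_mem (Finset.mem_univ _), Finset.card_univ, Fintype.card_fin]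
  omega

/-- The entries of the boxes `(1, 0)` and `(2, 0)` form an arbitrary pair `a < b` of positive
entries, hence `c = 1`. -/
theorem card_hook_two (hn : 3 ≤ n) (hμ : μ.rowLens = [n - 2, 1, 1]) :
    (Fintype.card (StdTableau n μ) : ℚ) = ((n : ℚ) - 1) * ((n : ℚ) - 2) / 2 ∧
      (patternColumns n μ).ncard = 1 := by
  have hcard : μ.card = n := by rw [← μ.sum_rowLens, hμ]; simp; omega
  have r0 : μ.rowLen 0 = n - 2 := by rw [μ.rowLen_eq_getD, hμ]; rfl
  have r1 : μ.rowLen 1 = 1 := by rw [μ.rowLen_eq_getD, hμ]; rfl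
  have r2 : μ.rowLen 2 = 1 := by rw [μ.rowLen_eq_getD, hμ]; rfl
  have r3 : ∀ i, μ.rowLen (i + 3) = 0 := fun i => by rw [μ.rowLen_eq_getD, hμ]; rfl
  have := card_and_ncard_of_twoRows (μ := μ) (v := 2) (c := 1) hn two_ne_zero
    (by omega) ?_ ?_
  · rw [this.1]
    exact ⟨card_lowerPairs_one hn, this.2⟩
  · rintro ⟨b, a⟩ hp
    obtain ⟨h1, h2, h3, h4⟩ := mem_lowerPairs.1 hp
    simp only at h1 h2 h3 h4
    have hone : ∀ l : Fin n, twoRows 2 ⟨b, a⟩ l = 1 ↔ l = ⟨a, by omega⟩ := by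
      intro l; simp only [twoRows, Fin.ext_iff]; split_ifs <;> simp <;> omega
    have htwo : ∀ l : Fin n, twoRows 2 ⟨b, a⟩ l = 2 ↔ l = ⟨b, h2⟩ := by
      intro l; simp only [twoRows, Fin.ext_iff]; split_ifs <;> simp <;> omega
    have hval : ∀ l : Fin n, twoRows 2 ⟨b, a⟩ l = 0 ∨ twoRows 2 ⟨b, a⟩ l = 1 ∨
        twoRows 2 ⟨b, a⟩ l = 2 := by
      intro l; unfold twoRows; split_ifs <;> simp
    refine exists_of_row_le hcard _ (fun k => ?_) (fun k i hi => ?_)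
    · rcases hval k with hk | hk | hk <;> rw [hk]
      · rw [r0]; exact card_twoRows_eq_zero two_ne_zero h4 h2
      · simp only [hone, r1]
        rw [Finset.filter_eq']; simp
      · simp only [htwo, r2]
        rw [Finset.filter_eq']; simp
    · have hzero : (Finset.univ.filter fun l => l < k ∧
          twoRows 2 ⟨b, a⟩ l = twoRows 2 ⟨b, a⟩ k).card = 0 := by
        refine Finset.card_eq_zero.2 (Finset.filter_eq_empty_iff.2 ?_)
        rintro l - ⟨e1, e2⟩
        rcases hval k with hk | hk | hk
        · omega
        · rw [hk, hone] at e2; rw [hone] at hk; exact e1.ne (e2.trans hk.symm)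
        · rw [hk, htwo] at e2; rw [htwo] at hk; exact e1.ne (e2.trans hk.symm)
      rw [hzero, Finset.card_pos]
      have hak : a ≤ k.val := by
        rcases hval k with hk | hk | hk
        · omega
        · rw [hone] at hk; rw [hk]
        · rw [htwo] at hk; rw [hk]; exact h4.le
      -- The earlier entry required in row `i` is `0` for the first row and `a` for the second.
      obtain rfl | ⟨rfl, hk⟩ : i = 0 ∨ (i = 1 ∧ twoRows 2 ⟨b, a⟩ k = 2) := by
        have := hval k
        omega
      · refine ⟨⟨0, by omega⟩, ?_⟩
        simp only [Finset.mem_filter, Finset.mem_univ, true_and, twoRows_eq_zero two_ne_zero,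
          Fin.lt_def]
        omega
      · refine ⟨⟨a, by omega⟩, ?_⟩
        rw [htwo] at hk
        simp [hone, hk, Fin.lt_def, h4]
  · intro T
    obtain ⟨a, ha1, ha2⟩ := T.exists_cell_eq (i := 1) (j := 0) (by omega)
    obtain ⟨b, hb1, hb2⟩ := T.exists_cell_eq (i := 2) (j := 0) (by omega)
    have hab : a.val < b.val := T.col_lt a b (by omega) (by omega)
    have ha := T.pos_of_row_ne_zero (a := a) (by omega)
    refine ⟨⟨b, a⟩, mem_lowerPairs.2 ⟨by simp only; omega, b.2, ha, hab⟩, fun k => ?_⟩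
    have hlt := T.lt_rowLen k
    unfold twoRows
    split_ifs with hka hkb
    · rw [Fin.ext hka, ha1]
    · rw [Fin.ext hkb, hb1]
    · rcases hrow : (T.cell k).1.1 with _ | _ | _ | i
      · rfl
      · rw [hrow, r1] at hlt
        exact absurd (congrArg Fin.val (cell_eq_iff T.cell (hrow.trans ha1.symm) (by omega))) hka
      · rw [hrow, r2] at hlt
        exact absurd (congrArg Fin.val (cell_eq_iff T.cell (hrow.trans hb1.symm) (by omega))) hkb
      · rw [hrow, r3] at hlt
        omega

/-- The second row holds `a < b`. Before `b` come `a` and the first two entries of the first row, so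
`b ≥ 3`; conversely `a ≥ 1` and `b ≥ 3` suffice, hence `c = 3`. -/
theorem card_two_rows (hn : 3 ≤ n) (hμ : μ.rowLens = [n - 2, 2]) :
    (Fintype.card (StdTableau n μ) : ℚ) = (n : ℚ) * ((n : ℚ) - 3) / 2 ∧
      (patternColumns n μ).ncard = 1 := by
  have hcard : μ.card = n := by rw [← μ.sum_rowLens, hμ]; simp; omega
  have r0 : μ.rowLen 0 = n - 2 := by rw [μ.rowLen_eq_getD, hμ]; rfl
  have r1 : μ.rowLen 1 = 2 := by rw [μ.rowLen_eq_getD, hμ]; rfl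
  have r2 : ∀ i, μ.rowLen (i + 2) = 0 := fun i => by rw [μ.rowLen_eq_getD, hμ]; rfl
  -- Row lengths decrease, so `2 ≤ n - 2`.
  have hn4 : 3 < n := by
    have := μ.rowLen_anti 0 1 zero_le_one
    omega
  have := card_and_ncard_of_twoRows (μ := μ) (v := 1) (c := 3) hn one_ne_zero hn4 ?_ ?_
  · rw [this.1]
    exact ⟨card_lowerPairs_three hn, this.2⟩
  · rintro ⟨b, a⟩ hp
    obtain ⟨h1, h2, h3, h4⟩ := mem_lowerPairs.1 hp
    simp only at h1 h2 h3 h4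
    have hone : ∀ l : Fin n, twoRows 1 ⟨b, a⟩ l = 1 ↔ l.val = a ∨ l.val = b := by
      intro l; simp only [twoRows]; split_ifs <;> simp <;> omega
    have hval : ∀ l : Fin n, twoRows 1 ⟨b, a⟩ l = 0 ∨ twoRows 1 ⟨b, a⟩ l = 1 := by
      intro l; unfold twoRows; split_ifs <;> simp
    refine exists_of_row_le hcard _ (fun k => ?_) (fun k i hi => ?_)
    · rcases hval k with hk | hk <;> rw [hk]
      · rw [r0]; exact card_twoRows_eq_zero one_ne_zero h4 h2
      · rw [r1]
        refine (Finset.card_le_card (t := {⟨a, by omega⟩, ⟨b, h2⟩}) fun l hl => ?_).trans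
          Finset.card_le_two
        simpa [hone, Fin.ext_iff] using hl
    · have hk : twoRows 1 ⟨b, a⟩ k = 1 := (hval k).resolve_left (by omega)
      obtain rfl : i = 0 := by omega
      rw [hk]
      simp only [hone, twoRows_eq_zero one_ne_zero]
      rcases (hone k).1 hk with hka | hkb
      · rw [Finset.card_eq_zero.2 (Finset.filter_eq_empty_iff.2 ?_), Finset.card_pos]
        · refine ⟨⟨0, by omega⟩, ?_⟩
          simp only [Finset.mem_filter, Finset.mem_univ, true_and, Fin.lt_def]
          omega
        · rintro l - ⟨e1, e2⟩
          rw [Fin.lt_def] at e1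
          omega
      -- Only `a` precedes `b` in the second row, while two first-row entries do: `0`, and whichever
      -- of `1` and `2` is not `a` (taking `1` if both are free).
      · refine lt_of_le_of_lt (b := 1) ?_ (Finset.one_lt_card.2
          ⟨⟨0, by omega⟩, ?_, ⟨if a = 1 then 2 else 1, by split_ifs <;> omega⟩, ?_, ?_⟩)
        · refine Finset.card_le_one.2 fun l hl m hm => Fin.ext ?_
          simp only [Finset.mem_filter, Finset.mem_univ, true_and, Fin.lt_def] at hl hm
          omega
        · simp only [Finset.mem_filter, Finset.mem_univ, true_and, Fin.lt_def]
          omega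
        · simp only [Finset.mem_filter, Finset.mem_univ, true_and, Fin.lt_def]
          by_cases h : a = 1 <;> simp only [h, if_true, if_false] <;> omega
        · simp only [ne_eq, Fin.ext_iff]
          split_ifs <;> exact not_false
  · intro T
    obtain ⟨a, ha1, ha2⟩ := T.exists_cell_eq (i := 1) (j := 0) (by omega)
    obtain ⟨b, hb1, hb2⟩ := T.exists_cell_eq (i := 1) (j := 1) (by omega)
    obtain ⟨q, hq1, hq2⟩ := T.exists_cell_eq (i := 0) (j := 1) (by omega)
    obtain ⟨p, hp1, hp2⟩ := T.exists_cell_eq (i := 0) (j := 0) (by omega)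
    have hab : a.val < b.val := T.row_lt a b (by omega) (by omega)
    have hpq : p.val < q.val := T.row_lt p q (by omega) (by omega)
    have hqb : q.val < b.val := T.col_lt q b (by omega) (by omega)
    have hpa : p.val < a.val := T.col_lt p a (by omega) (by omega)
    have haq : a.val ≠ q.val := fun e => by rw [Fin.ext e] at ha1; omega
    -- `p`, `q` and `a` are three distinct entries below `b`, so `b ≥ 3`.
    refine ⟨⟨b, a⟩, mem_lowerPairs.2 ⟨by simp only; omega, b.2, by simp only; omega, hab⟩,
      fun k => ?_⟩
    have hlt := T.lt_rowLen k
    unfold twoRows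
    split_ifs with hka hkb
    · rw [Fin.ext hka, ha1]
    · rw [Fin.ext hkb, hb1]
    · rcases hrow : (T.cell k).1.1 with _ | _ | i
      · rfl
      · rw [hrow, r1] at hlt
        rcases (show (T.cell k).1.2 = 0 ∨ (T.cell k).1.2 = 1 by omega) with h | h
        · exact absurd (congrArg Fin.val (cell_eq_iff T.cell (hrow.trans ha1.symm) (by omega))) hka
        · exact absurd (congrArg Fin.val (cell_eq_iff T.cell (hrow.trans hb1.symm) (by omega))) hkb
      · rw [hrow, r2] at hlt
        omega

end StdTableau

/-- For `n = 3` the list `[n - 2, 2]` is `[1, 2]`, which is not decreasing, so the clause for this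
shape is vacuous. The two quadratic sizes are stated in `ℚ` to avoid truncated subtraction and
division. -/
theorem mainTheorem9 (n : ℕ) (hn : 3 ≤ n) :
    -- the transform vanishes outside the four shapes
    (∀ f : Equiv.Perm (Fin n) ⧸ firstPerms n (n - 2) → ℂ,
      ∀ μ : YoungDiagram, μ.card = n → μ ∉ Lam n → cosetFourier f μ = 0) ∧
    -- on the four shapes, all columns outside a pattern that does not depend on `f` vanish
    (∀ f : Equiv.Perm (Fin n) ⧸ firstPerms n (n - 2) → ℂ,
      ∀ μ ∈ Lam n, ∀ T ∉ patternColumns n μ, ∀ S, cosetFourier f μ S T = 0) ∧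
    -- and all columns of the pattern do occur as non-zero columns, simultaneously
    (∃ f : Equiv.Perm (Fin n) ⧸ firstPerms n (n - 2) → ℂ,
      ∀ μ ∈ Lam n, ∀ T ∈ patternColumns n μ, ∃ S, cosetFourier f μ S T ≠ 0) ∧
    -- sizes of the matrices and numbers of columns in the pattern
    (∀ μ : YoungDiagram, μ.rowLens = [n] →
      Fintype.card (StdTableau n μ) = 1 ∧ (patternColumns n μ).ncard = 1) ∧
    (∀ μ : YoungDiagram, μ.rowLens = [n - 1, 1] →
      Fintype.card (StdTableau n μ) = n - 1 ∧ (patternColumns n μ).ncard = 2) ∧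
    (∀ μ : YoungDiagram, μ.rowLens = [n - 2, 2] →
      (Fintype.card (StdTableau n μ) : ℚ) = (n : ℚ) * ((n : ℚ) - 3) / 2 ∧
        (patternColumns n μ).ncard = 1) ∧
    (∀ μ : YoungDiagram, μ.rowLens = [n - 2, 1, 1] →
      (Fintype.card (StdTableau n μ) : ℚ) = ((n : ℚ) - 1) * ((n : ℚ) - 2) / 2 ∧
        (patternColumns n μ).ncard = 1) := by
  obtain ⟨f, hf⟩ := exists_cosetFourier_ne_zero n
  exact ⟨fun f _ _ hμ => cosetFourier_eq_zero hn f hμ,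
    fun f μ _ T hT S => cosetFourier_apply_eq_zero f μ hT S,
    ⟨f, fun μ _ T hT => hf μ T hT⟩,
    fun _ hμ => StdTableau.card_row hμ,
    fun _ hμ => StdTableau.card_hook_one hn hμ,
    fun _ hμ => StdTableau.card_two_rows hn hμ,
    fun _ hμ => StdTableau.card_hook_two hn hμ⟩
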